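/- Let $n\ge 2$, let $\Omega\subset\mathbb R^n$ be a bounded domain (open, connected, non-empty), let $h:\mathbb R\to\mathbb R$ be continuous and nondecreasing, and let $f:\mathbb R\to\mathbb R$ satisfy $f'=h$ (for example $f(t)=\int_0^t h(s)\,ds$). Write $Du$ for the weak Jacobian matrix of $u$ and $\operatorname{cof}A$ for the cofactor matrix, so that $A^T\operatorname{cof}A=(\det A)I$, and $A:B=\sum_{i,j}A_{ij}B_{ij}$. Suppose that $u\in W^{1,n}_{loc}(\Omega;\mathbb R^n)$ is a weak solution of $$\operatorname{div}\big(h(\det Du)\operatorname{cof}Du\big)=0\quad\text{in }\Omega,$$ that is, $h(\det Du)\operatorname{cof}Du\in L^1_{loc}(\Omega)$ and $\int_\Omega h(\det Du)\operatorname{cof}Du:D\zeta\,dx=0$ for all $\zeta\in C^1_c(\Omega;\mathbb R^n)$, and that $h(\det Du)$ is constant almost everywhere on $\Omega$. Let $G\subset\subset\Omega$ be open (in particular, any subdomain whose closure is a compact subset of $\Omega$). Then $f(\det Du)$ is integrable on $G$, and for every $v\in W^{1,n}(G;\mathbb R^n)$ with $v-u\in W^{1,n}_0(G;\mathbb R^n)$,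 where $W^{1,n}_0(G;\mathbb R^n)$ is the closure of $C_c^\infty(G;\mathbb R^n)$ in $W^{1,n}(G;\mathbb R^n)$, the negative part of $f(\det Dv)$ is integrable on $G$, and $$\int_G f(\det Du(x))\,dx\le\int_G f(\det Dv(x))\,dx,$$ where the right-hand side is an extended Lebesgue integral that may equal $+\infty$. -/

import Mathlib

open MeasureTheory Filter Topology
open scoped ENNReal ContDiff

noncomputable section

/-- The classical Jacobian matrix, with entries `∂ζ^i / ∂x_j`. -/
def jacobian {n : ℕ} (ζ : EuclideanSpace ℝ (Fin n) → EuclideanSpace ℝ (Fin n))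
    (x : EuclideanSpace ℝ (Fin n)) : Matrix (Fin n) (Fin n) ℝ :=
  Matrix.of fun i j => (fderiv ℝ ζ x (EuclideanSpace.single j 1)) i

/-- The cofactor matrix, normalized by `Aᵀ * cof A = det A • 1`. -/
def cof {n : ℕ} (A : Matrix (Fin n) (Fin n) ℝ) : Matrix (Fin n) (Fin n) ℝ :=
  A.adjugate.transpose

/-- The inner product `A : B = ∑ i j, A i j * B i j` of matrices. -/
def matInner {n : ℕ} (A B : Matrix (Fin n) (Fin n) ℝ) : ℝ :=
  ∑ i, ∑ j, A i j * B i j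

/-- `ζ` is of class `C^k` with compact support contained in `Ω`. -/
def IsTestFunction {n : ℕ} {F : Type*} [NormedAddCommGroup F] [NormedSpace ℝ F] (k : ℕ∞)
    (Ω : Set (EuclideanSpace ℝ (Fin n))) (ζ : EuclideanSpace ℝ (Fin n) → F) : Prop :=
  ContDiff ℝ k ζ ∧ HasCompactSupport ζ ∧ tsupport ζ ⊆ Ω

/-- `g ∈ L^p_loc(Ω)`: `g` is in `L^p(K)` for all compact `K ⊆ Ω`. -/
def MemLpLoc {n : ℕ} {F : Type*} [NormedAddCommGroup F]
    (Ω : Set (EuclideanSpace ℝ (Fin n))) (p : ℝ≥0∞) (g : EuclideanSpace ℝ (Fin n) → F) : Prop :=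
  ∀ K : Set (EuclideanSpace ℝ (Fin n)), IsCompact K → K ⊆ Ω → MemLp g p (volume.restrict K)

/-- `Du` is (a representative of) the weak (distributional) Jacobian matrix of the locally
integrable map `u` on the open set `Ω`; it is unique up to null sets of `Ω`. -/
structure HasWeakJacobian {n : ℕ} (Ω : Set (EuclideanSpace ℝ (Fin n)))
    (u : EuclideanSpace ℝ (Fin n) → EuclideanSpace ℝ (Fin n))
    (Du : EuclideanSpace ℝ (Fin n) → Matrix (Fin n) (Fin n) ℝ) : Prop where
  locInt : MemLpLoc Ω 1 u
  locInt_deriv : ∀ i j, MemLpLoc Ω 1 (fun x => Du x i j)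
  integral_eq : ∀ (i j : Fin n) (φ : EuclideanSpace ℝ (Fin n) → ℝ), IsTestFunction (⊤ : ℕ∞) Ω φ →
    ∫ x in Ω, u x i * fderiv ℝ φ x (EuclideanSpace.single j 1) = -∫ x in Ω, Du x i j * φ x

/-- `u ∈ W^{1,p}_loc(Ω; ℝⁿ)` with weak Jacobian `Du`. -/
structure MemW1pLoc {n : ℕ} (Ω : Set (EuclideanSpace ℝ (Fin n))) (p : ℝ≥0∞)
    (u : EuclideanSpace ℝ (Fin n) → EuclideanSpace ℝ (Fin n))
    (Du : EuclideanSpace ℝ (Fin n) → Matrix (Fin n) (Fin n) ℝ) : Prop where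
  weakJacobian : HasWeakJacobian Ω u Du
  memLpLoc : MemLpLoc Ω p u
  memLpLoc_deriv : ∀ i j, MemLpLoc Ω p (fun x => Du x i j)

/-- `u ∈ W^{1,p}(G; ℝⁿ)` with weak Jacobian `Du`. -/
structure MemW1p {n : ℕ} (G : Set (EuclideanSpace ℝ (Fin n))) (p : ℝ≥0∞)
    (u : EuclideanSpace ℝ (Fin n) → EuclideanSpace ℝ (Fin n))
    (Du : EuclideanSpace ℝ (Fin n) → Matrix (Fin n) (Fin n) ℝ) : Prop where
  weakJacobian : HasWeakJacobian G u Du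
  memLp : MemLp u p (volume.restrict G)
  memLp_deriv : ∀ i j, MemLp (fun x => Du x i j) p (volume.restrict G)

/-- `w ∈ W^{1,p}_0(G; ℝⁿ)` with weak Jacobian `Dw`: the closure of `C_c^∞(G; ℝⁿ)` in
`W^{1,p}(G; ℝⁿ)`. -/
structure MemW1pZero {n : ℕ} (G : Set (EuclideanSpace ℝ (Fin n))) (p : ℝ≥0∞)
    (w : EuclideanSpace ℝ (Fin n) → EuclideanSpace ℝ (Fin n))
    (Dw : EuclideanSpace ℝ (Fin n) → Matrix (Fin n) (Fin n) ℝ) : Prop where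
  memW1p : MemW1p G p w Dw
  approx : ∃ φ : ℕ → EuclideanSpace ℝ (Fin n) → EuclideanSpace ℝ (Fin n),
    (∀ k, IsTestFunction (⊤ : ℕ∞) G (φ k)) ∧
    Tendsto (fun k => eLpNorm (fun x => φ k x - w x) p (volume.restrict G)) atTop (𝓝 0) ∧
    ∀ i j, Tendsto (fun k => eLpNorm (fun x => jacobian (φ k) x i j - Dw x i j) p
      (volume.restrict G)) atTop (𝓝 0)

/-- `u`, with weak Jacobian `Du`, is a weak solution of `div (h(det Du) cof Du) = 0` in `Ω`. -/
structure IsWeakSolution {n : ℕ} (h : ℝ → ℝ) (Ω : Set (EuclideanSpace ℝ (Fin n)))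
    (u : EuclideanSpace ℝ (Fin n) → EuclideanSpace ℝ (Fin n))
    (Du : EuclideanSpace ℝ (Fin n) → Matrix (Fin n) (Fin n) ℝ) : Prop where
  memW11Loc : MemW1pLoc Ω 1 u Du
  flux_locInt : ∀ i j, MemLpLoc Ω 1 (fun x => h (Du x).det * cof (Du x) i j)
  integral_eq_zero : ∀ ζ : EuclideanSpace ℝ (Fin n) → EuclideanSpace ℝ (Fin n),
    IsTestFunction 1 Ω ζ →
    ∫ x in Ω, matInner (h (Du x).det • cof (Du x)) (jacobian ζ x) = 0

/-- The extended-valued Lebesgue integral `∫ g⁺ - ∫ g⁻`, meaningful as soon as one of the two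
terms is finite. -/
def extIntegral {α : Type*} [MeasurableSpace α] (μ : Measure α) (g : α → ℝ) : EReal :=
  ((∫⁻ x, ENNReal.ofReal (g x) ∂μ : ℝ≥0∞) : EReal)
    - ((∫⁻ x, ENNReal.ofReal (-g x) ∂μ : ℝ≥0∞) : EReal)

end

/-! Since `h` is nondecreasing, `f` is convex. Let `c` be the a.e. constant value of `h (Du x).det`,
let `d` be a value of `(Du x).det` with `h d = c`, and put ℓ(t) = f(d) + c(t - d). Then ℓ ≤ f
everywhere, with equality wherever `h` equals `c`, so f(det Du) = ℓ(det Du) a.e. It remains to see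
that ∫ ℓ(det Dv) = ∫ ℓ(det Du), that is, that the determinant is a null Lagrangian
(`setIntegral_det_eq_of_memW1pZero_sub`).

The null Lagrangian property rests on `integral_det_jacobian_eq_zero`, proved for C¹ maps without
second derivatives: for small s > 0 the map x + s g(x) is a bijection that is the identity off the
support of g, so the integral of det(I + s Dg) over that support is its volume. This integral is a
polynomial in s, hence a constant one, and its coefficient of sⁿ is ∫ det Dg. Mollification and the
continuity of ∫ det under Lⁿ convergence (`tendsto_integral_det`) carry the identity over to
W^{1,n}. -/

/-! ### Jacobian determinants of compactly supported C¹ maps -/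

theorem det_jacobian {n : ℕ} (g : EuclideanSpace ℝ (Fin n) → EuclideanSpace ℝ (Fin n))
    (x : EuclideanSpace ℝ (Fin n)) : (jacobian g x).det = (fderiv ℝ g x).det := by
  rw [ContinuousLinearMap.det, ← LinearMap.det_toMatrix (EuclideanSpace.basisFun (Fin n) ℝ).toBasis]
  congr 1

/-- Multilinearity in the rows. What matters later is that this is a polynomial in `s` whose only
term of degree `n` comes from `S = univ` and has coefficient `A.det`. -/
theorem det_one_add_smul_eq_sum {n : ℕ} (s : ℝ) (A : Matrix (Fin n) (Fin n) ℝ) :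
    (1 + s • A).det = ∑ S : Finset (Fin n), s ^ S.card *
      (Matrix.of fun i j => if i ∈ S then A i j else (1 : Matrix (Fin n) (Fin n) ℝ) i j).det := by
  let D : MultilinearMap ℝ (fun _ : Fin n => Fin n → ℝ) ℝ :=
    Matrix.detRowAlternating.toMultilinearMap
  let a : Fin n → Fin n → ℝ := fun i j => A i j
  let e : Fin n → Fin n → ℝ := fun i j => (1 : Matrix (Fin n) (Fin n) ℝ) i j
  have h1 : (1 + s • A).det = D ((fun i => s • a i) + e) := by
    rw [add_comm]; rfl
  rw [h1, MultilinearMap.map_add_univ]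
  refine Finset.sum_congr rfl fun S _ => ?_
  have h2 := D.map_piecewise_smul (fun _ : Fin n => s) (S.piecewise a e) S
  rw [Finset.prod_const, smul_eq_mul] at h2
  have h3 : S.piecewise (fun i => s • S.piecewise a e i) (S.piecewise a e)
      = S.piecewise (fun i => s • a i) e := by
    ext i j
    by_cases hi : i ∈ S <;> simp [hi]
  rw [h3] at h2
  rw [h2]
  have h4 : S.piecewise a e = fun i j => if i ∈ S then A i j else
      (1 : Matrix (Fin n) (Fin n) ℝ) i j := by
    ext i j
    by_cases hi : i ∈ S <;> simp [hi, a, e]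
  rw [h4]
  rfl

theorem continuous_jacobian {n : ℕ} {g : EuclideanSpace ℝ (Fin n) → EuclideanSpace ℝ (Fin n)}
    (hg : ContDiff ℝ 1 g) : Continuous (jacobian g) := by
  refine continuous_matrix fun i j => ?_
  have := hg.continuous_fderiv one_ne_zero
  simp only [jacobian, Matrix.of_apply]
  fun_prop

theorem jacobian_eq_zero_of_notMem {n : ℕ}
    {g : EuclideanSpace ℝ (Fin n) → EuclideanSpace ℝ (Fin n)} {x : EuclideanSpace ℝ (Fin n)}
    (hx : x ∉ tsupport g) : jacobian g x = 0 := by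
  ext i j
  simp [jacobian, fderiv_of_notMem_tsupport (𝕜 := ℝ) hx]

/-- A small compactly supported perturbation of the identity preserves the volume of any closed
set containing the support. -/
theorem setIntegral_det_one_add_smul_jacobian {n : ℕ}
    {g : EuclideanSpace ℝ (Fin n) → EuclideanSpace ℝ (Fin n)}
    (hg : ContDiff ℝ 1 g) (hgc : HasCompactSupport g) {B : Set (EuclideanSpace ℝ (Fin n))}
    (hB : MeasurableSet B) (hgB : tsupport g ⊆ B) :
    ∃ δ > 0, ∀ s ∈ Set.Ioo (0 : ℝ) δ,
      ∫ x in B, (1 + s • jacobian g x).det = volume.real B := by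
  obtain ⟨C, hC⟩ := hg.lipschitzWith_of_hasCompactSupport hgc one_ne_zero
  have hdet : ∀ᶠ L : EuclideanSpace ℝ (Fin n) →L[ℝ] EuclideanSpace ℝ (Fin n) in 𝓝 0,
      0 < (ContinuousLinearMap.id ℝ _ + L).det := by
    have : Continuous fun L : EuclideanSpace ℝ (Fin n) →L[ℝ] EuclideanSpace ℝ (Fin n) =>
        (ContinuousLinearMap.id ℝ _ + L).det :=
      ContinuousLinearMap.continuous_det.comp (by fun_prop)
    refine this.continuousAt.eventually_const_lt ?_
    simp [ContinuousLinearMap.det]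
  obtain ⟨η, hη, hηdet⟩ := Metric.eventually_nhds_iff.1 hdet
  have hC1 : (0 : ℝ) < C + 1 := by positivity
  -- The bound `s * C < 1` makes `Φ` bijective, as a perturbation of the identity; `s * C < η` keeps
  -- its Jacobian determinant positive. Dividing by `C + 1` covers `C = 0`.
  refine ⟨min η 1 / (C + 1), by positivity, fun s hs => ?_⟩
  have hs0 := hs.1
  have hsC : s * (C + 1) < min η 1 := (lt_div_iff₀ hC1).1 hs.2
  have hsC' : s * C < min η 1 := by nlinarith
  set Φ : EuclideanSpace ℝ (Fin n) → EuclideanSpace ℝ (Fin n) := fun x => x + s • g x with hΦ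
  have happ : ApproximatesLinearOn Φ
      ((ContinuousLinearEquiv.refl ℝ (EuclideanSpace ℝ (Fin n)) :
        EuclideanSpace ℝ (Fin n) ≃L[ℝ] EuclideanSpace ℝ (Fin n)) :
        EuclideanSpace ℝ (Fin n) →L[ℝ] EuclideanSpace ℝ (Fin n)) Set.univ
      (s.toNNReal * C) := by
    intro x _ y _
    have : Φ x - Φ y - (x - y) = s • (g x - g y) := by simp only [hΦ, smul_sub]; abel
    have h2 := hC.dist_le_mul x y
    rw [dist_eq_norm, dist_eq_norm] at h2
    simp only [ContinuousLinearEquiv.coe_refl, ContinuousLinearMap.id_apply]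
    rw [this, norm_smul, Real.norm_of_nonneg hs0.le]
    simp only [NNReal.coe_mul, Real.coe_toNNReal _ hs0.le, mul_assoc]
    gcongr
  have hc : Subsingleton (EuclideanSpace ℝ (Fin n)) ∨ (s.toNNReal * C) <
      ‖((ContinuousLinearEquiv.refl ℝ (EuclideanSpace ℝ (Fin n))).symm :
        EuclideanSpace ℝ (Fin n) →L[ℝ] EuclideanSpace ℝ (Fin n))‖₊⁻¹ := by
    rcases subsingleton_or_nontrivial (EuclideanSpace ℝ (Fin n)) with h | h
    · exact Or.inl h
    · right
      simp only [ContinuousLinearEquiv.refl_symm, ContinuousLinearEquiv.coe_refl]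
      rw [show ‖ContinuousLinearMap.id ℝ (EuclideanSpace ℝ (Fin n))‖₊ = 1 from
        NNReal.eq ContinuousLinearMap.norm_id, inv_one, ← NNReal.coe_lt_coe]
      rw [NNReal.coe_mul, Real.coe_toNNReal _ hs0.le]
      exact hsC'.trans_le (min_le_right _ _)
  have hinj : Function.Injective Φ := by
    have := happ.injOn hc
    exact Set.injOn_univ.1 this
  have hsurj : Function.Surjective Φ := happ.surjective hc
  have hfix : ∀ x ∉ B, Φ x = x := fun x hx => by
    simp [hΦ, image_eq_zero_of_notMem_tsupport (fun h => hx (hgB h))]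
  -- A bijection that fixes every point of the complement of `B` maps `B` onto itself.
  have himg : Φ '' B = B := by
    have h1 : Φ '' Bᶜ = Bᶜ := by
      refine (Set.image_congr fun x hx => hfix x hx).trans (Set.image_id' _)
    rw [Set.image_compl_eq ⟨hinj, hsurj⟩] at h1
    exact compl_injective h1
  have hder : ∀ x, HasFDerivAt Φ (ContinuousLinearMap.id ℝ _ + s • fderiv ℝ g x) x := fun x =>
    (hasFDerivAt_id x).add
      (((hg.differentiable one_ne_zero) x).hasFDerivAt.const_smul s)
  have hjac : ∀ x, (1 + s • jacobian g x).det
      = |(ContinuousLinearMap.id ℝ _ + s • fderiv ℝ g x).det| := fun x => by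
    rw [abs_of_pos]
    · rw [← (hder x).fderiv, ← det_jacobian]
      congr 1
      ext i j
      simp only [jacobian, (hder x).fderiv]
      simp [Matrix.one_apply]
    · refine hηdet ?_
      rw [dist_zero_right, norm_smul, Real.norm_of_nonneg hs0.le]
      calc s * ‖fderiv ℝ g x‖ ≤ s * C := by
            gcongr
            exact norm_fderiv_le_of_lipschitz ℝ hC
        _ < η := hsC'.trans_le (min_le_left _ _)
  have := integral_image_eq_integral_abs_det_fderiv_smul volume hB
    (fun x _ => (hder x).hasFDerivWithinAt) hinj.injOn (fun _ => (1 : ℝ))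
  rw [himg] at this
  simp only [hjac]
  simpa using this.symm

/-- The Jacobian determinant of a compactly supported `C^1` map has zero integral. -/
theorem integral_det_jacobian_eq_zero {n : ℕ} (hn : n ≠ 0)
    {g : EuclideanSpace ℝ (Fin n) → EuclideanSpace ℝ (Fin n)}
    (hg : ContDiff ℝ 1 g) (hgc : HasCompactSupport g) :
    ∫ x, (jacobian g x).det = 0 := by
  have hBc : IsCompact (tsupport g) := hgc
  obtain ⟨δ, hδ, hvol⟩ := setIntegral_det_one_add_smul_jacobian hg hgc
    hBc.measurableSet subset_rfl
  set a : Finset (Fin n) → ℝ := fun S => ∫ x in tsupport g,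
    (Matrix.of fun i j =>
      if i ∈ S then jacobian g x i j else (1 : Matrix (Fin n) (Fin n) ℝ) i j).det with ha
  have hcont : ∀ S : Finset (Fin n), Continuous fun x =>
      (Matrix.of fun i j =>
      if i ∈ S then jacobian g x i j else (1 : Matrix (Fin n) (Fin n) ℝ) i j).det := by
    intro S
    refine Continuous.matrix_det (continuous_matrix fun i j => ?_)
    by_cases hi : i ∈ S
    · simpa [hi] using (continuous_jacobian hg).matrix_elem i j
    · simpa [hi] using continuous_const
  set P : Polynomial ℝ := ∑ S : Finset (Fin n), Polynomial.monomial S.card (a S) with hP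
  have heval : ∀ s ∈ Set.Ioo (0 : ℝ) δ,
      P.eval s = (Polynomial.C (volume.real (tsupport g))).eval s := by
    intro s hs
    rw [Polynomial.eval_C, ← hvol s hs, hP, Polynomial.eval_finsetSum]
    simp only [det_one_add_smul_eq_sum]
    rw [integral_finsetSum]
    · refine Finset.sum_congr rfl fun S _ => ?_
      rw [Polynomial.eval_monomial, integral_const_mul, mul_comm]
    · intro S _
      exact ((hcont S).continuousOn.integrableOn_compact hBc).const_mul _
  -- Two polynomials that agree on an interval coincide; comparing coefficients of degree `n ≠ 0`
  -- then gives zero.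
  have hPC : P = Polynomial.C (volume.real (tsupport g)) :=
    Polynomial.eq_of_infinite_eval_eq _ _ ((Set.Ioo_infinite hδ).mono heval)
  have hcoeff : P.coeff n = a Finset.univ := by
    rw [hP, Polynomial.finsetSum_coeff, Finset.sum_eq_single Finset.univ]
    · simp
    · intro S _ hS
      rw [Polynomial.coeff_monomial, if_neg]
      intro h
      exact hS ((Finset.card_eq_iff_eq_univ S).1 (by simpa using h))
    · simp
  rw [hPC, Polynomial.coeff_C_of_ne_zero hn, ha] at hcoeff
  simp only [Finset.mem_univ, if_true] at hcoeff
  refine (setIntegral_eq_integral_of_forall_compl_eq_zero fun x hx => ?_).symm.trans hcoeff.symm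
  -- The zero matrix has determinant 0 only in positive size.
  have : Nonempty (Fin n) := ⟨⟨0, Nat.pos_of_ne_zero hn⟩⟩
  rw [jacobian_eq_zero_of_notMem hx, Matrix.det_zero]

/-! ### Continuity of the integral of the determinant in Lⁿ -/

/-- Hölder's inequality with exponents n/(n-1) and n. -/
theorem lintegral_enorm_pow_mul_enorm_le {α E F : Type*} [MeasurableSpace α] {μ : Measure α}
    [NormedAddCommGroup E] [NormedAddCommGroup F] {n : ℕ} (hn : 2 ≤ n) {M : α → E} {d : α → F}
    (hM : AEStronglyMeasurable M μ) (hd : AEStronglyMeasurable d μ) :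
    ∫⁻ x, ‖M x‖ₑ ^ (n - 1) * ‖d x‖ₑ ∂μ ≤ eLpNorm M n μ ^ (n - 1) * eLpNorm d n μ := by
  have hn0 : (n : ℝ≥0∞) ≠ 0 := by simp; omega
  have hn2 : (2 : ℝ) ≤ n := by exact_mod_cast hn
  have hcast : ((n - 1 : ℕ) : ℝ) = n - 1 := by
    rw [Nat.cast_sub (by omega)]; simp
  have hpos : (0 : ℝ) < n - 1 := by linarith
  have hpq : ((n : ℝ) / (n - 1)).HolderConjugate n :=
    (Real.HolderConjugate.conjExponent (by linarith)).symm
  refine (ENNReal.lintegral_mul_le_Lp_mul_Lq μ hpq (hM.enorm.pow_const (n - 1)) hd.enorm).trans ?_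
  rw [eLpNorm_eq_lintegral_rpow_enorm_toReal hn0 (ENNReal.natCast_ne_top n),
    eLpNorm_eq_lintegral_rpow_enorm_toReal hn0 (ENNReal.natCast_ne_top n), ENNReal.toReal_natCast,
    ← ENNReal.rpow_natCast, ← ENNReal.rpow_mul, hcast]
  refine le_of_eq ?_
  congr 2
  · refine lintegral_congr fun x => ?_
    rw [← ENNReal.rpow_natCast, ← ENNReal.rpow_mul, hcast]
    congr 1
    field_simp
  · field_simp

/-- The determinant as a continuous multilinear map of the rows. -/
noncomputable def detCML (n : ℕ) : ContinuousMultilinearMap ℝ (fun _ : Fin n => Fin n → ℝ) ℝ where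
  toMultilinearMap := Matrix.detRowAlternating.toMultilinearMap
  cont := by
    change Continuous fun A : Fin n → Fin n → ℝ => Matrix.det (Matrix.of A)
    exact Continuous.matrix_det continuous_id

theorem detCML_apply {n : ℕ} (A : Fin n → Fin n → ℝ) : detCML n A = (Matrix.of A).det := rfl

theorem norm_det_sub_det_le {n : ℕ} (A B : Fin n → Fin n → ℝ) :
    ‖Matrix.det (Matrix.of A) - Matrix.det (Matrix.of B)‖ ≤
      ‖detCML n‖ * n * max ‖A‖ ‖B‖ ^ (n - 1) * ‖A - B‖ := by
  simpa [detCML_apply] using (detCML n).norm_image_sub_le A B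

theorem memLp_rows {α : Type*} [MeasurableSpace α] {μ : Measure α} {n : ℕ} {p : ℝ≥0∞}
    {A : α → Matrix (Fin n) (Fin n) ℝ} (hA : ∀ i j, MemLp (fun x => A x i j) p μ) :
    MemLp (fun x i j => A x i j) p μ :=
  memLp_pi_iff.2 fun i => memLp_pi_iff.2 fun j => hA i j

theorem eLpNorm_rows_le {α : Type*} [MeasurableSpace α] {μ : Measure α} {n : ℕ} {p : ℝ≥0∞}
    (hp : 1 ≤ p) {A : α → Fin n → Fin n → ℝ}
    (hA : ∀ i j, AEStronglyMeasurable (fun x => A x i j) μ) :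
    eLpNorm A p μ ≤ ∑ i, ∑ j, eLpNorm (fun x => A x i j) p μ := by
  calc eLpNorm A p μ ≤ eLpNorm (∑ i, ∑ j, fun x => ‖A x i j‖) p μ := by
        refine eLpNorm_mono_real fun x => ?_
        simp only [Finset.sum_apply]
        exact (pi_norm_le_iff_of_nonneg (by positivity)).2 fun i =>
          ((pi_norm_le_iff_of_nonneg (by positivity)).2 fun j =>
            Finset.single_le_sum (f := fun j => ‖A x i j‖) (fun _ _ => norm_nonneg _)
              (Finset.mem_univ j)).trans
          (Finset.single_le_sum (f := fun i => ∑ j, ‖A x i j‖)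
            (fun _ _ => by positivity) (Finset.mem_univ i))
    _ ≤ ∑ i, eLpNorm (∑ j, fun x => ‖A x i j‖) p μ :=
        eLpNorm_sum_le (fun i _ => Finset.aestronglyMeasurable_sum _ fun j _ => (hA i j).norm) hp
    _ ≤ ∑ i, ∑ j, eLpNorm (fun x => ‖A x i j‖) p μ :=
        Finset.sum_le_sum fun i _ => eLpNorm_sum_le (fun j _ => (hA i j).norm) hp
    _ = _ := by simp only [eLpNorm_norm]

theorem integrable_det {α : Type*} [MeasurableSpace α] {μ : Measure α} {n : ℕ} (hn : n ≠ 0)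
    {A : α → Matrix (Fin n) (Fin n) ℝ} (hA : ∀ i j, MemLp (fun x => A x i j) n μ) :
    Integrable (fun x => (A x).det) μ := by
  have hrow := memLp_rows hA
  refine Integrable.mono' ((hrow.integrable_norm_pow hn).const_mul ‖detCML n‖) ?_
    (ae_of_all _ fun x => ?_)
  · exact (detCML n).cont.comp_aestronglyMeasurable hrow.aestronglyMeasurable
  · have := (detCML n).le_opNorm_mul_pow_card_of_le (m := fun i j => A x i j) le_rfl
    rw [Fintype.card_fin] at this
    exact this

/-- The pointwise bound has degree n-1 in the matrices and degree 1 in their difference, so Hölder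
applies. The norm of `A` is bounded through `A - B` and `B`, so that the right-hand side visibly
tends to zero when `A` converges to a fixed `B`. -/
theorem lintegral_enorm_det_sub_det_le {α : Type*} [MeasurableSpace α] {μ : Measure α} {n : ℕ}
    (hn : 2 ≤ n) {A B : α → Matrix (Fin n) (Fin n) ℝ} (hA : ∀ i j, MemLp (fun x => A x i j) n μ)
    (hB : ∀ i j, MemLp (fun x => B x i j) n μ) :
    ∫⁻ x, ‖(A x).det - (B x).det‖ₑ ∂μ ≤ ENNReal.ofReal (‖detCML n‖ * n) *
      ((eLpNorm (fun x i j => A x i j - B x i j) n μ + eLpNorm (fun x i j => B x i j) n μ) ^ (n - 1)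
        * eLpNorm (fun x i j => A x i j - B x i j) n μ) := by
  have hn1 : (1 : ℝ≥0∞) ≤ n := by exact_mod_cast (by omega : 1 ≤ n)
  have hb := memLp_rows hB
  have hd : MemLp (fun x i j => A x i j - B x i j) n μ :=
    memLp_rows (A := fun x => A x - B x) fun i j => (hA i j).sub (hB i j)
  set d : α → Fin n → Fin n → ℝ := fun x i j => A x i j - B x i j
  set b : α → Fin n → Fin n → ℝ := fun x i j => B x i j
  set M : α → ℝ := fun x => ‖d x‖ + ‖b x‖ with hM
  have hpt : ∀ x, ‖(A x).det - (B x).det‖ₑ ≤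
      ENNReal.ofReal (‖detCML n‖ * n) * (‖M x‖ₑ ^ (n - 1) * ‖d x‖ₑ) := by
    intro x
    have h1 := norm_det_sub_det_le (fun i j => A x i j) (fun i j => B x i j)
    have hM0 : 0 ≤ M x := by positivity
    have h2 : max ‖fun i j => A x i j‖ ‖fun i j => B x i j‖ ≤ M x := by
      refine max_le ?_ (le_add_of_nonneg_left (norm_nonneg _))
      have : (fun i j => A x i j) = d x + b x := by ext i j; simp [d, b]
      rw [this]
      exact norm_add_le _ _
    have h3 : ‖(A x).det - (B x).det‖ ≤ ‖detCML n‖ * n * (M x ^ (n - 1) * ‖d x‖) := by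
      rw [← mul_assoc]
      refine h1.trans ?_
      gcongr
      exact le_of_eq rfl
    rw [← ofReal_norm, ← ofReal_norm (M x), ← ofReal_norm (d x), Real.norm_of_nonneg hM0,
      ← ENNReal.ofReal_pow hM0, ← ENNReal.ofReal_mul (by positivity),
      ← ENNReal.ofReal_mul (by positivity)]
    exact ENNReal.ofReal_le_ofReal h3
  have hMm : AEStronglyMeasurable M μ :=
    hd.aestronglyMeasurable.norm.add hb.aestronglyMeasurable.norm
  calc ∫⁻ x, ‖(A x).det - (B x).det‖ₑ ∂μ
      ≤ ∫⁻ x, ENNReal.ofReal (‖detCML n‖ * n) * (‖M x‖ₑ ^ (n - 1) * ‖d x‖ₑ) ∂μ :=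
        lintegral_mono hpt
    _ = ENNReal.ofReal (‖detCML n‖ * n) * ∫⁻ x, ‖M x‖ₑ ^ (n - 1) * ‖d x‖ₑ ∂μ :=
        lintegral_const_mul' _ _ ENNReal.ofReal_ne_top
    _ ≤ ENNReal.ofReal (‖detCML n‖ * n) * (eLpNorm M n μ ^ (n - 1) * eLpNorm d n μ) := by
        gcongr
        exact lintegral_enorm_pow_mul_enorm_le hn hMm hd.aestronglyMeasurable
    _ ≤ _ := by
        gcongr
        have := eLpNorm_add_le hd.aestronglyMeasurable.norm hb.aestronglyMeasurable.norm hn1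
        rwa [eLpNorm_norm, eLpNorm_norm] at this

/-- The map `A ↦ ∫ det A` is continuous for `L^n` convergence of the entries. -/
theorem tendsto_integral_det {α : Type*} [MeasurableSpace α] {μ : Measure α} {n : ℕ}
    (hn : 2 ≤ n) {A : ℕ → α → Matrix (Fin n) (Fin n) ℝ} {B : α → Matrix (Fin n) (Fin n) ℝ}
    (hA : ∀ k i j, MemLp (fun x => A k x i j) n μ) (hB : ∀ i j, MemLp (fun x => B x i j) n μ)
    (hAB : ∀ i j, Tendsto (fun k => eLpNorm (fun x => A k x i j - B x i j) n μ) atTop (𝓝 0)) :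
    Tendsto (fun k => ∫ x, (A k x).det ∂μ) atTop (𝓝 (∫ x, (B x).det ∂μ)) := by
  have hn1 : (1 : ℝ≥0∞) ≤ n := by exact_mod_cast (by omega : 1 ≤ n)
  refine tendsto_integral_of_L1 _ (integrable_det (by omega) hB).aestronglyMeasurable
    (Eventually.of_forall fun k => integrable_det (by omega) (hA k)) ?_
  have hd : Tendsto (fun k => eLpNorm (fun x i j => A k x i j - B x i j) n μ) atTop (𝓝 0) := by
    refine tendsto_of_tendsto_of_tendsto_of_le_of_le tendsto_const_nhds
      (h := fun k => ∑ i, ∑ j, eLpNorm (fun x => A k x i j - B x i j) n μ) ?_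
      (fun _ => zero_le) fun k => eLpNorm_rows_le hn1 fun i j =>
        ((hA k i j).sub (hB i j)).aestronglyMeasurable
    have := tendsto_finsetSum Finset.univ fun i _ =>
      tendsto_finsetSum (Finset.univ : Finset (Fin n)) fun j _ => hAB i j
    simpa using this
  have hbtop : eLpNorm (fun x i j => B x i j) n μ ≠ ⊤ := (memLp_rows hB).eLpNorm_ne_top
  refine tendsto_of_tendsto_of_tendsto_of_le_of_le tendsto_const_nhds ?_
      (fun _ => zero_le) fun k => lintegral_enorm_det_sub_det_le hn (hA k) hB
  have h1 := (ENNReal.Tendsto.pow (n := n - 1)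
    (hd.add (tendsto_const_nhds (x := eLpNorm (fun x i j => B x i j) n μ))))
  rw [zero_add] at h1
  have h2 := ENNReal.Tendsto.const_mul (a := ENNReal.ofReal (‖detCML n‖ * n))
    (ENNReal.Tendsto.mul h1 (Or.inr ENNReal.zero_ne_top) hd
      (Or.inr (ENNReal.pow_ne_top hbtop))) (Or.inr ENNReal.ofReal_ne_top)
  simpa using h2

/-! ### Mollification in L^p and of weak derivatives -/

theorem tendsto_eLpNorm_sub_translate {E : Type*} [NormedAddCommGroup E] [NormedSpace ℝ E]
    [FiniteDimensional ℝ E] [MeasurableSpace E] [BorelSpace E] {μ : Measure E} [μ.IsAddHaarMeasure]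
    {p : ℝ≥0∞} (hp1 : 1 ≤ p) (hp : p ≠ ⊤) {g : E → ℝ} (hg : MemLp g p μ) :
    Tendsto (fun t => eLpNorm (fun x => g (x - t) - g x) p μ) (𝓝 0) (𝓝 0) := by
  have : Fact (1 ≤ p) := ⟨hp1⟩
  -- Translations form a family of measure-preserving maps that is continuous in the compact-open
  -- topology, and composition with such a family is continuous in L^p for finite `p`.
  let T : C(E, C(E, E)) := ContinuousMap.curry ⟨fun q : E × E => q.2 - q.1, by fun_prop⟩
  have hT : ∀ t, MeasurePreserving (T t) μ μ := fun t => measurePreserving_sub_right μ t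
  have h := Filter.Tendsto.compMeasurePreservingLp (tendsto_const_nhds (x := hg.toLp g))
    (T.continuous.tendsto 0) hT (hT 0) hp
  rw [tendsto_iff_edist_tendsto_0] at h
  refine h.congr fun t => ?_
  rw [Lp.toLp_compMeasurePreserving, Lp.toLp_compMeasurePreserving, Lp.edist_toLp_toLp]
  congr 1
  ext x
  simp [T]

/-- The mollification error at x is the average of g(x - t) - g(x) over the probability measure with
density `φ.normed μ`. Monotonicity of L^p norms on a probability space bounds its p-th power by the
average of p-th powers; Tonelli then reduces the claim to translations. -/
theorem eLpNorm_convolution_sub_le {E : Type*} [NormedAddCommGroup E] [NormedSpace ℝ E]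
    [FiniteDimensional ℝ E] [MeasurableSpace E] [BorelSpace E] {μ : Measure E} [μ.IsAddHaarMeasure]
    {p : ℝ≥0∞} (hp1 : 1 ≤ p) (hp : p ≠ ⊤) {g : E → ℝ} (hgm : StronglyMeasurable g)
    (hg : MemLp g p μ) (φ : ContDiffBump (0 : E)) {ε : ℝ≥0∞}
    (hε : ∀ t ∈ Metric.closedBall (0 : E) φ.rOut, eLpNorm (fun x => g (x - t) - g x) p μ ≤ ε) :
    eLpNorm (fun x => convolution g (φ.normed μ) (ContinuousLinearMap.mul ℝ ℝ) μ x - g x) p μ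
      ≤ ε := by
  have hp0 : p ≠ 0 := (one_pos.trans_le hp1).ne'
  have hpr : 0 < p.toReal := ENNReal.toReal_pos hp0 hp
  set ρ := φ.normed μ with hρ
  have hρc : Continuous ρ := φ.continuous_normed
  set w : E → ℝ≥0∞ := fun t => ENNReal.ofReal (ρ t) with hw
  have hwm : Measurable w := hρc.measurable.ennreal_ofReal
  set ν := μ.withDensity w with hν
  have hwint : ∫⁻ t, w t ∂μ = 1 := by
    rw [hw, ← ofReal_integral_eq_lintegral_ofReal φ.integrable_normed
      (ae_of_all _ fun x => φ.nonneg_normed x), φ.integral_normed, ENNReal.ofReal_one]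
  have : IsProbabilityMeasure ν := ⟨by rw [hν, withDensity_apply _ .univ, setLIntegral_univ, hwint]⟩
  have hjm : StronglyMeasurable fun q : E × E => g (q.1 - q.2) - g q.1 :=
    (hgm.comp_measurable (by fun_prop)).sub (hgm.comp_measurable measurable_fst)
  have hloc : LocallyIntegrable g μ := hg.locallyIntegrable hp1
  have hpt : ∀ x, ‖convolution g ρ (ContinuousLinearMap.mul ℝ ℝ) μ x - g x‖ₑ ^ p.toReal
      ≤ ∫⁻ t, ‖g (x - t) - g x‖ₑ ^ p.toReal ∂ν := by
    intro x
    have hex := (φ.hasCompactSupport_normed (μ := μ)).convolutionExists_right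
      (ContinuousLinearMap.mul ℝ ℝ) hloc hρc x
    have h1 : convolution g ρ (ContinuousLinearMap.mul ℝ ℝ) μ x - g x
        = ∫ t, (g (x - t) - g x) * ρ t ∂μ := by
      have h2 : Integrable (fun t => g (x - t) * ρ t) μ := hex.integrable_swap
      have h3 : ∫ t, g x * ρ t ∂μ = g x := by
        rw [integral_const_mul, φ.integral_normed, mul_one]
      simp only [sub_mul]
      rw [integral_sub h2 (φ.integrable_normed.const_mul _), h3, convolution_mul_swap]
    have hxm : Measurable fun t => g (x - t) - g x :=
      (hgm.measurable.comp (by fun_prop)).sub_const _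
    have h4 : ‖convolution g ρ (ContinuousLinearMap.mul ℝ ℝ) μ x - g x‖ₑ
        ≤ eLpNorm (fun t => g (x - t) - g x) 1 ν := by
      rw [h1, eLpNorm_one_eq_lintegral_enorm, hν,
        lintegral_withDensity_eq_lintegral_mul _ hwm hxm.enorm]
      refine (enorm_integral_le_lintegral_enorm _).trans (le_of_eq (lintegral_congr fun t => ?_))
      rw [enorm_mul, Real.enorm_of_nonneg (φ.nonneg_normed t), mul_comm]
      rfl
    have h5 := h4.trans (eLpNorm_le_eLpNorm_of_exponent_le hp1 hxm.aestronglyMeasurable)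
    rw [eLpNorm_eq_lintegral_rpow_enorm_toReal hp0 hp, one_div, ENNReal.le_rpow_inv_iff hpr] at h5
    exact h5
  rw [eLpNorm_eq_lintegral_rpow_enorm_toReal hp0 hp, one_div, ENNReal.rpow_inv_le_iff hpr]
  calc ∫⁻ x, ‖convolution g ρ (ContinuousLinearMap.mul ℝ ℝ) μ x - g x‖ₑ ^ p.toReal ∂μ
      ≤ ∫⁻ x, ∫⁻ t, ‖g (x - t) - g x‖ₑ ^ p.toReal ∂ν ∂μ := lintegral_mono hpt
    _ = ∫⁻ t, ∫⁻ x, ‖g (x - t) - g x‖ₑ ^ p.toReal ∂μ ∂ν :=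
        lintegral_lintegral_swap (hjm.measurable.enorm.pow_const _).aemeasurable
    _ ≤ ∫⁻ _, ε ^ p.toReal ∂ν := by
        refine lintegral_mono_ae ?_
        rw [hν, ae_withDensity_iff hwm]
        -- Only translations by vectors in the support of the bump carry weight, and there `hε`
        -- applies.
        refine ae_of_all _ fun t ht => ?_
        have ht' : t ∈ Metric.closedBall (0 : E) φ.rOut := by
          refine Metric.ball_subset_closedBall ?_
          rw [← φ.support_normed_eq (μ := μ)]
          intro h0
          exact ht (by rw [hw]; simp [hρ, h0])
        have := hε t ht'
        rwa [eLpNorm_eq_lintegral_rpow_enorm_toReal hp0 hp, one_div,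
          ENNReal.rpow_inv_le_iff hpr] at this
    _ = ε ^ p.toReal := by simp

/-- Mollifications converge in `L^p`. -/
theorem tendsto_eLpNorm_convolution_sub {E : Type*} [NormedAddCommGroup E] [NormedSpace ℝ E]
    [FiniteDimensional ℝ E] [MeasurableSpace E] [BorelSpace E] {μ : Measure E} [μ.IsAddHaarMeasure]
    {p : ℝ≥0∞} (hp1 : 1 ≤ p) (hp : p ≠ ⊤) {g : E → ℝ} (hg : MemLp g p μ)
    {φ : ℕ → ContDiffBump (0 : E)} (hφ : Tendsto (fun k => (φ k).rOut) atTop (𝓝 0)) :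
    Tendsto (fun k => eLpNorm (fun x => convolution g ((φ k).normed μ)
      (ContinuousLinearMap.mul ℝ ℝ) μ x - g x) p μ) atTop (𝓝 0) := by
  have hgg := hg.aestronglyMeasurable.ae_eq_mk
  -- Tonelli requires joint measurability of g(x - t), hence a strongly measurable representative.
  set g' := hg.aestronglyMeasurable.mk g
  have hg' : MemLp g' p μ := hg.ae_eq hgg
  have hconv : ∀ k, eLpNorm (fun x => convolution g ((φ k).normed μ)
      (ContinuousLinearMap.mul ℝ ℝ) μ x - g x) p μ = eLpNorm (fun x => convolution g'
      ((φ k).normed μ) (ContinuousLinearMap.mul ℝ ℝ) μ x - g' x) p μ := by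
    intro k
    refine eLpNorm_congr_ae ?_
    filter_upwards [hgg] with x hx
    rw [convolution_congr _ hgg (ae_eq_refl _), hx]
  simp only [hconv]
  rw [ENNReal.tendsto_nhds_zero]
  intro ε hε
  obtain ⟨δ, hδ, h⟩ := Metric.eventually_nhds_iff.1
    (ENNReal.tendsto_nhds_zero.1 (tendsto_eLpNorm_sub_translate hp1 hp hg') ε hε)
  filter_upwards [hφ.eventually_lt_const hδ] with k hk
  exact eLpNorm_convolution_sub_le hp1 hp hg.aestronglyMeasurable.stronglyMeasurable_mk hg' (φ k)
    fun t ht => h ((Metric.mem_closedBall.1 ht).trans_lt hk)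

/-- A mollification of the truncated function `u` has, at points far from the complement of the
truncation set, the mollified weak derivative as its derivative. -/
theorem fderiv_convolution_indicator_apply {E : Type*} [NormedAddCommGroup E] [NormedSpace ℝ E]
    [FiniteDimensional ℝ E] [MeasurableSpace E] [BorelSpace E] {μ : Measure E} [μ.IsAddHaarMeasure]
    {Ω K : Set E} (hK : IsCompact K) (hKΩ : K ⊆ Ω) {u w : E → ℝ} {e : E}
    (hu : IntegrableOn u K μ)
    (huw : ∀ ψ : E → ℝ, ContDiff ℝ ∞ ψ → HasCompactSupport ψ → tsupport ψ ⊆ Ω →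
      ∫ x in Ω, u x * fderiv ℝ ψ x e ∂μ = -∫ x in Ω, w x * ψ x ∂μ)
    (φ : ContDiffBump (0 : E)) {x : E} (hx : Metric.closedBall x φ.rOut ⊆ K) :
    fderiv ℝ (convolution (K.indicator u) (φ.normed μ) (ContinuousLinearMap.mul ℝ ℝ) μ) x e
      = convolution (K.indicator w) (φ.normed μ) (ContinuousLinearMap.mul ℝ ℝ) μ x := by
  set ρ := φ.normed μ with hρ
  have hρd : ContDiff ℝ ∞ ρ := φ.contDiff_normed
  have hρc : HasCompactSupport ρ := φ.hasCompactSupport_normed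
  have hU : LocallyIntegrable (K.indicator u) μ :=
    ((integrable_indicator_iff hK.measurableSet).2 hu).locallyIntegrable
  have hρ1 : ContDiff ℝ 1 ρ := φ.contDiff_normed
  rw [(hρc.hasFDerivAt_convolution_right (ContinuousLinearMap.mul ℝ ℝ) hU hρ1 x).fderiv,
    convolution_precompR_apply _ hU (hρc.fderiv ℝ) (hρ1.continuous_fderiv one_ne_zero),
    convolution_mul, convolution_mul]
  -- The reflected bump serves as test function in the definition of the weak derivative; the sign
  -- from the reflection cancels the sign from integration by parts. Its support lies in `K`, so the
  -- truncation has no effect.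
  set ψ : E → ℝ := fun t => ρ (x - t) with hψ
  have hψd : ContDiff ℝ ∞ ψ := hρd.comp (contDiff_const.sub contDiff_id)
  have hts : tsupport ψ ⊆ Metric.closedBall x φ.rOut := by
    refine closure_minimal (fun t ht => ?_) Metric.isClosed_closedBall
    have : x - t ∈ Function.support ρ := ht
    rw [hρ, φ.support_normed_eq, mem_ball_zero_iff, ← dist_eq_norm, dist_comm] at this
    exact Metric.mem_closedBall.2 this.le
  have hψc : HasCompactSupport ψ :=
    HasCompactSupport.of_support_subset_isCompact (isCompact_closedBall x φ.rOut)
      ((subset_tsupport ψ).trans hts)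
  have hψ' : ∀ t, fderiv ℝ ρ (x - t) e = -fderiv ℝ ψ t e := by
    intro t
    have h1 : HasFDerivAt ψ ((fderiv ℝ ρ (x - t)).comp (-ContinuousLinearMap.id ℝ E)) t :=
      ((hρ1.differentiable one_ne_zero (x - t)).hasFDerivAt).comp t
        ((hasFDerivAt_id t).const_sub x)
    rw [h1.fderiv]
    simp
  have hK0 : ∀ t ∉ K, ψ t = 0 ∧ fderiv ℝ ψ t = 0 := fun t ht =>
    have ht' : t ∉ tsupport ψ := fun h => ht (hx (hts h))
    ⟨image_eq_zero_of_notMem_tsupport ht', fderiv_of_notMem_tsupport (𝕜 := ℝ) ht'⟩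
  have h1 : ∫ t, K.indicator u t * fderiv ℝ ρ (x - t) e ∂μ
      = -∫ t in Ω, u t * fderiv ℝ ψ t e ∂μ := by
    rw [setIntegral_eq_integral_of_forall_compl_eq_zero
      (fun t ht => by simp [(hK0 t fun h => ht (hKΩ h)).2]), ← integral_neg]
    refine integral_congr_ae (ae_of_all _ fun t => ?_)
    by_cases ht : t ∈ K
    · simp [ht, hψ']
    · simp [ht, (hK0 t ht).2]
  have h2 : ∫ t, K.indicator w t * ρ (x - t) ∂μ = ∫ t in Ω, w t * ψ t ∂μ := by
    rw [setIntegral_eq_integral_of_forall_compl_eq_zero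
      (fun t ht => by simp [(hK0 t fun h => ht (hKΩ h)).1])]
    refine integral_congr_ae (ae_of_all _ fun t => ?_)
    by_cases ht : t ∈ K
    · simp [ht, hψ]
    · simp [ht, (hK0 t ht).1]
  rw [h1, h2, huw ψ hψd hψc (hts.trans (hx.trans hKΩ)), neg_neg]

/-! ### The determinant as a null Lagrangian on W^{1,n} -/

theorem memLp_jacobian {n : ℕ} {g : EuclideanSpace ℝ (Fin n) → EuclideanSpace ℝ (Fin n)}
    (hg : ContDiff ℝ 1 g) (hgc : HasCompactSupport g) (p : ℝ≥0∞)
    (S : Set (EuclideanSpace ℝ (Fin n))) (i j : Fin n) :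
    MemLp (fun x => jacobian g x i j) p (volume.restrict S) := by
  refine MemLp.restrict S (Continuous.memLp_of_hasCompactSupport
    ((continuous_jacobian hg).matrix_elem i j) ?_)
  refine HasCompactSupport.of_support_subset_isCompact hgc fun x hx => ?_
  by_contra h
  exact hx (by simp [jacobian_eq_zero_of_notMem h])

theorem jacobian_add {n : ℕ} {g k : EuclideanSpace ℝ (Fin n) → EuclideanSpace ℝ (Fin n)}
    (hg : ContDiff ℝ 1 g) (hk : ContDiff ℝ 1 k) (x : EuclideanSpace ℝ (Fin n)) :
    jacobian (g + k) x = jacobian g x + jacobian k x := by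
  ext i j
  simp [jacobian, fderiv_add (hg.differentiable one_ne_zero x) (hk.differentiable one_ne_zero x)]

/-- The integrands agree off `tsupport k`, so their difference may be integrated over the whole
space, where both integrals vanish. -/
theorem setIntegral_det_jacobian_add {n : ℕ} (hn : n ≠ 0)
    {g k : EuclideanSpace ℝ (Fin n) → EuclideanSpace ℝ (Fin n)}
    (hg : ContDiff ℝ 1 g) (hgc : HasCompactSupport g)
    (hk : ContDiff ℝ 1 k) (hkc : HasCompactSupport k) :
    ∫ x in tsupport k, (jacobian g x + jacobian k x).det
      = ∫ x in tsupport k, (jacobian g x).det := by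
  have hint : ∀ {g : EuclideanSpace ℝ (Fin n) → EuclideanSpace ℝ (Fin n)}, ContDiff ℝ 1 g →
      HasCompactSupport g → Integrable (fun x => (jacobian g x).det) := fun hg hgc => by
    rw [← Measure.restrict_univ (μ := volume)]
    exact integrable_det hn fun i j => memLp_jacobian hg hgc _ _ i j
  rw [← sub_eq_zero]
  have hgk : ContDiff ℝ 1 (g + k) := hg.add hk
  simp only [← jacobian_add hg hk]
  rw [← integral_sub (hint hgk (hgc.add hkc)).integrableOn (hint hg hgc).integrableOn,
    setIntegral_eq_integral_of_forall_compl_eq_zero, integral_sub (hint hgk (hgc.add hkc))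
      (hint hg hgc), integral_det_jacobian_eq_zero hn hg hgc,
    integral_det_jacobian_eq_zero hn hgk (hgc.add hkc), sub_zero]
  intro x hx
  rw [jacobian_add hg hk, jacobian_eq_zero_of_notMem hx, add_zero, sub_self]

/-- Maps in `W^{1,p}_loc` are approximated near a compact set by smooth compactly supported maps. -/
theorem MemW1pLoc.exists_contDiff_tendsto {n : ℕ} {Ω : Set (EuclideanSpace ℝ (Fin n))}
    {p : ℝ≥0∞} (hp1 : 1 ≤ p) (hp : p ≠ ⊤)
    {u : EuclideanSpace ℝ (Fin n) → EuclideanSpace ℝ (Fin n)}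
    {Du : EuclideanSpace ℝ (Fin n) → Matrix (Fin n) (Fin n) ℝ} (hΩ : IsOpen Ω)
    (hu : MemW1pLoc Ω p u Du) {K : Set (EuclideanSpace ℝ (Fin n))} (hK : IsCompact K)
    (hKΩ : K ⊆ Ω) :
    ∃ g : ℕ → EuclideanSpace ℝ (Fin n) → EuclideanSpace ℝ (Fin n),
      (∀ k, ContDiff ℝ 1 (g k)) ∧ (∀ k, HasCompactSupport (g k)) ∧
      ∀ i j, Tendsto (fun k => eLpNorm (fun x => jacobian (g k) x i j - Du x i j) p
        (volume.restrict K)) atTop (𝓝 0) := by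
  -- The truncation is to a closed `δ`-neighbourhood of `K` inside `Ω`, and the mollification radii
  -- are at most `δ`: at points of `K` the mollifier sees only the untruncated map.
  obtain ⟨δ, hδ, hδΩ⟩ := hK.exists_cthickening_subset_open hΩ hKΩ
  set K' := Metric.cthickening δ K with hK'
  have hK'c : IsCompact K' := hK.cthickening
  have hKK' : K ⊆ K' := Metric.self_subset_cthickening K
  let φ : ℕ → ContDiffBump (0 : EuclideanSpace ℝ (Fin n)) := fun k =>
    ⟨δ / (k + 2), δ / (k + 1), by positivity, by gcongr; norm_num⟩
  have hφ : Tendsto (fun k => (φ k).rOut) atTop (𝓝 0) := by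
    simpa [φ, div_eq_mul_inv] using
      (tendsto_one_div_add_atTop_nhds_zero_nat (𝕜 := ℝ)).const_mul δ
  have hφδ : ∀ k, (φ k).rOut ≤ δ := fun k =>
    div_le_self hδ.le (by linarith [(Nat.cast_nonneg k : (0 : ℝ) ≤ k)])
  have hU : ∀ i, IntegrableOn (fun x => u x i) K' volume := fun i => by
    have := hu.weakJacobian.locInt K' hK'c hδΩ
    exact memLp_one_iff_integrable.1 (this.eval_piLp i)
  have hV : ∀ i j, MemLp (K'.indicator fun x => Du x i j) p volume := fun i j =>
    (memLp_indicator_iff_restrict hK'c.measurableSet).2 (hu.memLpLoc_deriv i j K' hK'c hδΩ)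
  let c : ℕ → Fin n → EuclideanSpace ℝ (Fin n) → ℝ := fun k i =>
    convolution (K'.indicator fun x => u x i) ((φ k).normed volume)
      (ContinuousLinearMap.mul ℝ ℝ) volume
  have hc : ∀ k i, ContDiff ℝ 1 (c k i) := fun k i => by
    have := (φ k).hasCompactSupport_normed (μ := volume) |>.contDiff_convolution_right
      (ContinuousLinearMap.mul ℝ ℝ) (n := 1)
      ((integrable_indicator_iff hK'c.measurableSet).2 (hU i)).locallyIntegrable
      (φ k).contDiff_normed
    exact_mod_cast this
  have hcc : ∀ k i, HasCompactSupport (c k i) := fun k i =>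
    HasCompactSupport.convolution _
      (HasCompactSupport.of_support_subset_isCompact hK'c Set.support_indicator_subset)
      (φ k).hasCompactSupport_normed
  refine ⟨fun k x => WithLp.toLp 2 fun i => c k i x, fun k => ?_, fun k => ?_, fun i j => ?_⟩
  · exact contDiff_euclidean.2 fun i => hc k i
  · have : (fun x => WithLp.toLp 2 fun i => c k i x)
        = ∑ i, fun x => c k i x • EuclideanSpace.single i (1 : ℝ) := by
      ext x i
      simp [Finset.sum_apply, Pi.single_apply]
    change HasCompactSupport fun x => WithLp.toLp 2 fun i => c k i x
    rw [this]
    exact Finset.sum_induction _ HasCompactSupport (fun _ _ h1 h2 => h1.add h2)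
      HasCompactSupport.zero fun i _ => (hcc k i).smul_right
  · refine tendsto_of_tendsto_of_tendsto_of_le_of_le tendsto_const_nhds
      (tendsto_eLpNorm_convolution_sub hp1 hp (hV i j) hφ) (fun _ => zero_le) fun k => ?_
    refine le_trans (le_of_eq (eLpNorm_congr_ae ?_))
      (eLpNorm_mono_measure _ (Measure.restrict_le_self (s := K)))
    filter_upwards [ae_restrict_mem hK.measurableSet] with x hx
    have hball : Metric.closedBall x (φ k).rOut ⊆ K' :=
      (Metric.closedBall_subset_closedBall (hφδ k)).trans
        (Metric.closedBall_subset_cthickening hx δ)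
    rw [← fderiv_convolution_indicator_apply hK'c hδΩ (hU i)
      (fun ψ h1 h2 h3 => hu.weakJacobian.integral_eq i j ψ ⟨h1, h2, h3⟩) (φ k) hball,
      Set.indicator_of_mem (hKK' hx)]
    congr 1
    simp only [jacobian, Matrix.of_apply]
    have hd : HasFDerivAt (fun x => WithLp.toLp 2 fun i => c k i x)
        (fderiv ℝ (fun x => WithLp.toLp 2 fun i => c k i x) x) x :=
      ((contDiff_euclidean.2 fun i => hc k i).differentiable one_ne_zero x).hasFDerivAt
    have hdi : HasFDerivAt (c k i) ((EuclideanSpace.proj i).comp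
        (fderiv ℝ (fun x => WithLp.toLp 2 fun i => c k i x) x)) x :=
      (EuclideanSpace.proj i : EuclideanSpace ℝ (Fin n) →L[ℝ] ℝ).hasFDerivAt.comp x hd
    change _ = fderiv ℝ (c k i) x (EuclideanSpace.single j 1)
    rw [hdi.fderiv]
    rfl

/-- Passage to the limit from smooth approximations of `u`. Integrating over `tsupport φ` alone
means that Lⁿ convergence on this compact set suffices. -/
theorem MemW1pLoc.setIntegral_det_add_jacobian {n : ℕ} (hn : 2 ≤ n)
    {Ω : Set (EuclideanSpace ℝ (Fin n))}
    {u : EuclideanSpace ℝ (Fin n) → EuclideanSpace ℝ (Fin n)}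
    {Du : EuclideanSpace ℝ (Fin n) → Matrix (Fin n) (Fin n) ℝ} (hΩ : IsOpen Ω)
    (hu : MemW1pLoc Ω n u Du) {φ : EuclideanSpace ℝ (Fin n) → EuclideanSpace ℝ (Fin n)}
    (hφ : ContDiff ℝ 1 φ) (hφc : HasCompactSupport φ) (hφΩ : tsupport φ ⊆ Ω) :
    ∫ x in tsupport φ, (Du x + jacobian φ x).det = ∫ x in tsupport φ, (Du x).det := by
  have hn1 : (1 : ℝ≥0∞) ≤ n := by exact_mod_cast (by omega : 1 ≤ n)
  obtain ⟨g, hg, hgc, hgt⟩ := hu.exists_contDiff_tendsto hn1 (ENNReal.natCast_ne_top n) hΩ hφc hφΩ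
  have hDu := fun i j => hu.memLpLoc_deriv i j _ hφc hφΩ
  have h1 := tendsto_integral_det hn (fun k => memLp_jacobian (hg k) (hgc k) n (tsupport φ)) hDu hgt
  have h2 := tendsto_integral_det hn (μ := volume.restrict (tsupport φ))
    (A := fun k x => jacobian (g k) x + jacobian φ x) (B := fun x => Du x + jacobian φ x)
    (fun k i j => (memLp_jacobian (hg k) (hgc k) n _ i j).add (memLp_jacobian hφ hφc n _ i j))
    (fun i j => (hDu i j).add (memLp_jacobian hφ hφc n _ i j))
    (fun i j => by simpa using hgt i j)
  simp only [setIntegral_det_jacobian_add (by omega) (hg _) (hgc _) hφ hφc] at h2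
  exact tendsto_nhds_unique h2 h1

/-- The Jacobian determinant is a null Lagrangian on `W^{1,n}`. -/
theorem setIntegral_det_eq_of_memW1pZero_sub {n : ℕ} (hn : 2 ≤ n)
    {Ω : Set (EuclideanSpace ℝ (Fin n))} (hΩ : IsOpen Ω)
    {u v : EuclideanSpace ℝ (Fin n) → EuclideanSpace ℝ (Fin n)}
    {Du Dv : EuclideanSpace ℝ (Fin n) → Matrix (Fin n) (Fin n) ℝ} (hu : MemW1pLoc Ω n u Du)
    {G : Set (EuclideanSpace ℝ (Fin n))} (hGm : MeasurableSet G) (hGΩ : G ⊆ Ω)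
    (hDu : ∀ i j, MemLp (fun x => Du x i j) n (volume.restrict G))
    (hDv : ∀ i j, MemLp (fun x => Dv x i j) n (volume.restrict G))
    (huv : MemW1pZero G n (fun x => v x - u x) (fun x => Dv x - Du x)) :
    ∫ x in G, (Dv x).det = ∫ x in G, (Du x).det := by
  obtain ⟨φ, hφ, -, hφt⟩ := huv.approx
  have hφ1 : ∀ k, ContDiff ℝ 1 (φ k) := fun k => (hφ k).1.of_le (by exact_mod_cast le_top)
  have hJ := fun k => memLp_jacobian (hφ1 k) (hφ k).2.1 (n : ℝ≥0∞)
  have hA : ∀ k i j, MemLp (fun x => (Du x + jacobian (φ k) x) i j) n (volume.restrict G) :=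
    fun k i j => (hDu i j).add (hJ k G i j)
  have h1 := tendsto_integral_det hn hA hDv (fun i j => by
    refine (hφt i j).congr fun k => ?_
    congr 1
    ext x
    simp only [Matrix.add_apply, Matrix.sub_apply]
    ring)
  -- The matrices `Du + jacobian (φ k)` converge to `Dv` in Lⁿ, while the integrals of their
  -- determinants do not depend on `k`.
  refine tendsto_nhds_unique h1 (tendsto_const_nhds.congr fun k => ?_)
  have hK := (hφ k).2.2
  have hint := integrable_det (by omega) (hA k)
  have hint' := integrable_det (by omega) hDu
  refine (sub_eq_zero.1 ?_).symm
  rw [← integral_sub hint hint', setIntegral_eq_of_subset_of_forall_sdiff_eq_zero hGm hK,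
    integral_sub (IntegrableOn.mono_set hint hK) (IntegrableOn.mono_set hint' hK),
    hu.setIntegral_det_add_jacobian hn hΩ (hφ1 k) (hφ k).2.1 (hK.trans hGΩ), sub_self]
  rintro x ⟨-, hx⟩
  rw [jacobian_eq_zero_of_notMem hx, add_zero, sub_self]

/-! ### Convexity of f and the minimality of u -/

theorem tangent_le_of_hasDerivAt_of_monotone {f h : ℝ → ℝ} (hh : Monotone h)
    (hf : ∀ t, HasDerivAt f (h t) t) (d t : ℝ) : f d + h d * (t - d) ≤ f t := by
  have hc : Continuous f := continuous_iff_continuousAt.2 fun t => (hf t).continuousAt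
  rcases lt_trichotomy d t with hdt | rfl | htd
  · obtain ⟨ξ, hξ, hslope⟩ := exists_hasDerivAt_eq_slope f h hdt hc.continuousOn fun x _ => hf x
    have h1 := hh hξ.1.le
    rw [hslope, le_div_iff₀ (sub_pos.2 hdt)] at h1
    linarith
  · simp
  · obtain ⟨ξ, hξ, hslope⟩ := exists_hasDerivAt_eq_slope f h htd hc.continuousOn fun x _ => hf x
    have h1 := hh hξ.2.le
    rw [hslope, div_le_iff₀ (sub_pos.2 htd)] at h1
    linarith

theorem extIntegral_eq_integral {α : Type*} [MeasurableSpace α] {μ : Measure α} {g : α → ℝ}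
    (hg : Integrable g μ) : extIntegral μ g = ((∫ x, g x ∂μ : ℝ) : EReal) := by
  have h1 : ∫⁻ x, ENNReal.ofReal (g x) ∂μ ≠ ⊤ := hg.lintegral_lt_top.ne
  have h2 : ∫⁻ x, ENNReal.ofReal (-g x) ∂μ ≠ ⊤ := hg.neg.lintegral_lt_top.ne
  rw [extIntegral, integral_eq_lintegral_pos_part_sub_lintegral_neg_part hg, EReal.coe_sub,
    EReal.coe_ennreal_toReal h1, EReal.coe_ennreal_toReal h2]

theorem extIntegral_mono {α : Type*} [MeasurableSpace α] {μ : Measure α} {g k : α → ℝ}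
    (hgk : ∀ x, g x ≤ k x) : extIntegral μ g ≤ extIntegral μ k := by
  refine EReal.sub_le_sub ?_ ?_ <;> rw [EReal.coe_ennreal_le_coe_ennreal_iff] <;>
    refine lintegral_mono fun x => ENNReal.ofReal_le_ofReal ?_
  · exact hgk x
  · exact neg_le_neg (hgk x)

theorem mainTheorem8 (n : ℕ) (hn : 2 ≤ n)
    (Ω : Set (EuclideanSpace ℝ (Fin n)))
    (hΩ_open : IsOpen Ω) (hΩ_conn : IsConnected Ω) (hΩ_bdd : Bornology.IsBounded Ω)
    (h f : ℝ → ℝ) (hh_cont : Continuous h) (hh_mono : Monotone h)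
    (hf : ∀ t, HasDerivAt f (h t) t)
    (u : EuclideanSpace ℝ (Fin n) → EuclideanSpace ℝ (Fin n))
    (Du : EuclideanSpace ℝ (Fin n) → Matrix (Fin n) (Fin n) ℝ)
    (hu : MemW1pLoc Ω (n : ℝ≥0∞) u Du)
    (hu_sol : IsWeakSolution h Ω u Du)
    (hu_const : ∃ c : ℝ, ∀ᵐ x ∂(volume.restrict Ω), h (Du x).det = c)
    (G : Set (EuclideanSpace ℝ (Fin n)))
    (hG_open : IsOpen G) (hG_compact : IsCompact (closure G)) (hG_sub : closure G ⊆ Ω) :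
    Integrable (fun x => f (Du x).det) (volume.restrict G) ∧
    ∀ (v : EuclideanSpace ℝ (Fin n) → EuclideanSpace ℝ (Fin n))
      (Dv : EuclideanSpace ℝ (Fin n) → Matrix (Fin n) (Fin n) ℝ),
      MemW1p G (n : ℝ≥0∞) v Dv →
      MemW1pZero G (n : ℝ≥0∞) (fun x => v x - u x) (fun x => Dv x - Du x) →
      ∫⁻ x in G, ENNReal.ofReal (-f (Dv x).det) < ⊤ ∧
      extIntegral (volume.restrict G) (fun x => f (Du x).det)
        ≤ extIntegral (volume.restrict G) (fun x => f (Dv x).det) := by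
  obtain ⟨c, hc⟩ := hu_const
  have hGΩ : G ⊆ Ω := subset_closure.trans hG_sub
  have hfin : IsFiniteMeasure (volume.restrict G) :=
    isFiniteMeasure_restrict.2 ((measure_mono subset_closure).trans_lt hG_compact.measure_lt_top).ne
  have hDu : ∀ i j, MemLp (fun x => Du x i j) n (volume.restrict G) := fun i j =>
    (hu.memLpLoc_deriv i j _ hG_compact hG_sub).mono_measure
      (Measure.restrict_mono subset_closure le_rfl)
  have hn0 : n ≠ 0 := by omega
  have hdet := integrable_det hn0 hDu
  -- `Ω` has positive measure, so the a.e. identity holds at some point; this supplies a tangent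
  -- line to `f` of slope `c`.
  obtain ⟨x₀, hx₀⟩ : ∃ x, h (Du x).det = c := by
    have : (ae (volume.restrict Ω)).NeBot := by
      rw [ae_neBot, Ne, Measure.restrict_eq_zero]
      exact (hΩ_open.measure_pos volume hΩ_conn.nonempty).ne'
    exact hc.exists
  set d := (Du x₀).det
  have hlow : ∀ t, f d + c * (t - d) ≤ f t := fun t =>
    hx₀ ▸ tangent_le_of_hasDerivAt_of_monotone hh_mono hf d t
  -- The tangent at `t` also has slope `c`; evaluated at `d`, it gives the inequality reverse to
  -- `hlow`.
  have heq : ∀ t, h t = c → f d + c * (t - d) = f t := fun t ht => by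
    have := tangent_le_of_hasDerivAt_of_monotone hh_mono hf t d
    rw [ht] at this
    linarith [hlow t]
  have hae : (fun x => f d + c * ((Du x).det - d)) =ᵐ[volume.restrict G]
      fun x => f (Du x).det := by
    filter_upwards [ae_restrict_of_ae_restrict_of_subset hGΩ hc] with x hx using heq _ hx
  have hint : ∀ D : EuclideanSpace ℝ (Fin n) → Matrix (Fin n) (Fin n) ℝ,
      Integrable (fun x => (D x).det) (volume.restrict G) →
      Integrable (fun x => f d + c * ((D x).det - d)) (volume.restrict G) := fun D hD =>
    (integrable_const _).add ((hD.sub (integrable_const _)).const_mul c)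
  have hfu := (hint Du hdet).congr hae
  refine ⟨hfu, fun v Dv hv hvu => ?_⟩
  have hdetv := integrable_det hn0 hv.memLp_deriv
  have hnull := setIntegral_det_eq_of_memW1pZero_sub hn hΩ_open hu hG_open.measurableSet hGΩ hDu
    hv.memLp_deriv hvu
  have hval : ∀ D : EuclideanSpace ℝ (Fin n) → Matrix (Fin n) (Fin n) ℝ,
      Integrable (fun x => (D x).det) (volume.restrict G) →
      ∫ x in G, (f d + c * ((D x).det - d)) =
        volume.real G * (f d - c * d) + c * ∫ x in G, (D x).det := fun D hD => by
    have : (fun x => f d + c * ((D x).det - d)) = fun x => (f d - c * d) + c * (D x).det := by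
      ext x; ring
    rw [this, integral_add (integrable_const _) (hD.const_mul c), integral_const_mul,
      setIntegral_const, smul_eq_mul]
  constructor
  -- The negative part of f(det Dv) is dominated by that of the integrable affine minorant.
  · refine lt_of_le_of_lt (lintegral_mono fun x => ENNReal.ofReal_le_ofReal
      (neg_le_neg (hlow (Dv x).det))) (hint Dv hdetv).neg.lintegral_lt_top
  · calc extIntegral (volume.restrict G) (fun x => f (Du x).det)
        = extIntegral (volume.restrict G) (fun x => f d + c * ((Dv x).det - d)) := by
          rw [extIntegral_eq_integral hfu, extIntegral_eq_integral (hint Dv hdetv),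
            ← integral_congr_ae hae, hval Du hdet, hval Dv hdetv, hnull]
      _ ≤ _ := extIntegral_mono fun x => hlow (Dv x).det
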